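/- Let $K$ be a field and let $\Gamma$ be a quiver (with arbitrary, possibly infinite, sets of vertices and arrows). Let $K\Gamma$ be its path coalgebra: the vector space with basis all paths of $\Gamma$ (vertices being the paths of length $0$), with $\Delta(p)=\sum_{qr=p}q\otimes r$ for every path $p$, $\varepsilon(v)=1$ for a vertex $v$ and $\varepsilon(p)=0$ for a path $p$ of positive length. A path subcoalgebra of $K\Gamma$ is a subcoalgebra that has a linear basis consisting of paths. A coalgebra $C$ is called left (respectively right) co-Frobenius if $C$ embeds in the dual algebra $C^*$ as a left (respectively right) $C^*$-module. For an integer $s\ge 1$ let $K[\mathbb A_\infty|s]$ be the subcoalgebra of the path coalgebra of the quiver $\mathbb A_\infty$ (vertex set $\mathbb Z$, exactly one arrow $i\to i+1$ for each $i\in\mathbb Z$ and no other arrows) spanned by all paths of length at most $s$, that is, by the paths from $k$ to $l$ with $k\le l\le r(k)$, where $r(k)=k+s$. For integers $n,s\ge 1$ let $K[\mathbb C_n,s]$ be the subcoalgebra of the path coalgebra of the cyclic quiver $\mathbb C_n$ (vertex set $\mathbb Z/n\mathbb Z$, exactly one arrow $i\to i+1$ for each $i$ and no other arrows; for $n=1$,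 one vertex with one loop) spanned by all paths of length at most $s$. Let $C\subseteq K\Gamma$ be a path subcoalgebra that is both left and right co-Frobenius. Then $C$ is a direct sum of subcoalgebras $C=\bigoplus_{i\in I}C_i$, where each $C_i$ is isomorphic, as a coalgebra, to $K[\mathbb A_\infty|s]$ for some $s\ge 1$, or to $K[\mathbb C_n,s]$ for some $n,s\ge 1$, or to the trivial coalgebra $K$. -/

import Mathlib

open scoped TensorProduct

universe u v w

noncomputable section

/-! ### Subcoalgebras of a coalgebra over a field -/

/-- A subcoalgebra of a `K`-coalgebra `A`: a subspace `C` with `Δ(C) ⊆ C ⊗ C`, where `C ⊗ C` is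
viewed inside `A ⊗ A`. -/
structure Subcoalgebra (K : Type*) (A : Type*) [Field K] [AddCommGroup A] [Module K A]
    [Coalgebra K A] extends Submodule K A where
  comul_mem' : ∀ x ∈ carrier, Coalgebra.comul (R := K) x ∈
    LinearMap.range (TensorProduct.map toSubmodule.subtype toSubmodule.subtype)

namespace Subcoalgebra

variable {K : Type*} {A : Type*} [Field K] [AddCommGroup A] [Module K A] [Coalgebra K A]

instance : SetLike (Subcoalgebra K A) A where
  coe C := C.carrier
  coe_injective C D h := by
    cases C; cases D; congr; exact SetLike.coe_injective h

instance : AddSubgroupClass (Subcoalgebra K A) A where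
  add_mem {C} _ _ ha hb := C.toSubmodule.add_mem ha hb
  zero_mem C := C.toSubmodule.zero_mem
  neg_mem {C} _ ha := C.toSubmodule.neg_mem ha

instance : SMulMemClass (Subcoalgebra K A) K A where
  smul_mem {C} r _ ha := C.toSubmodule.smul_mem r ha

variable (C : Subcoalgebra K A)

/-- The inclusion of a subcoalgebra. -/
def subtype : C →ₗ[K] A := SMulMemClass.subtype C

theorem subtype_injective : Function.Injective C.subtype := Subtype.coe_injective

/-- The inclusion `C ⊗ C → A ⊗ A`. -/
def subtype₂ : C ⊗[K] C →ₗ[K] A ⊗[K] A := TensorProduct.map C.subtype C.subtype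

theorem subtype₂_injective : Function.Injective C.subtype₂ :=
  TensorProduct.map_injective_of_flat_flat _ _ C.subtype_injective C.subtype_injective

theorem comul_subtype_mem (x : C) :
    (Coalgebra.comul (R := K) ∘ₗ C.subtype) x ∈ LinearMap.range C.subtype₂ :=
  C.comul_mem' x x.2

/-- The restriction of the comultiplication of `A` to `C → C ⊗ C`. -/
def comulAux : C →ₗ[K] C ⊗[K] C :=
  (LinearEquiv.ofInjective C.subtype₂ C.subtype₂_injective).symm.toLinearMap ∘ₗ
    LinearMap.codRestrict (LinearMap.range C.subtype₂) (Coalgebra.comul (R := K) ∘ₗ C.subtype)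
      C.comul_subtype_mem

theorem subtype₂_comp_comulAux :
    TensorProduct.map C.subtype C.subtype ∘ₗ C.comulAux = Coalgebra.comul (R := K) ∘ₗ C.subtype := by
  ext x
  change C.subtype₂ ((LinearEquiv.ofInjective C.subtype₂ C.subtype₂_injective).symm _) = _
  rw [LinearEquiv.ofInjective_symm_apply]
  rfl

/-- A subcoalgebra is a coalgebra, with comultiplication and counit restricted from `A`. -/
instance instCoalgebra : Coalgebra K C where
  comul := C.comulAux
  counit := Coalgebra.counit (R := K) ∘ₗ C.subtype
  coassoc := by
    have hinj : Function.Injective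
        (TensorProduct.map C.subtype (TensorProduct.map C.subtype C.subtype)) :=
      TensorProduct.map_injective_of_flat_flat _ _ C.subtype_injective C.subtype₂_injective
    rw [← LinearMap.cancel_left hinj]
    have h := C.subtype₂_comp_comulAux
    have e1 : TensorProduct.map C.subtype (TensorProduct.map C.subtype C.subtype) ∘ₗ
        (TensorProduct.assoc K C C C).toLinearMap =
        (TensorProduct.assoc K A A A).toLinearMap ∘ₗ
          TensorProduct.map (TensorProduct.map C.subtype C.subtype) C.subtype := by
      ext; rfl
    rw [← LinearMap.comp_assoc, e1]
    have e2 : TensorProduct.map (TensorProduct.map C.subtype C.subtype) C.subtype ∘ₗ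
        C.comulAux.rTensor C =
        (Coalgebra.comul (R := K)).rTensor A ∘ₗ TensorProduct.map C.subtype C.subtype := by
      rw [LinearMap.rTensor, LinearMap.rTensor, ← TensorProduct.map_comp,
        ← TensorProduct.map_comp, h, LinearMap.id_comp, LinearMap.comp_id]
    have e3 : TensorProduct.map C.subtype (TensorProduct.map C.subtype C.subtype) ∘ₗ
        C.comulAux.lTensor C =
        (Coalgebra.comul (R := K)).lTensor A ∘ₗ TensorProduct.map C.subtype C.subtype := by
      rw [LinearMap.lTensor, LinearMap.lTensor, ← TensorProduct.map_comp,
        ← TensorProduct.map_comp, h, LinearMap.id_comp, LinearMap.comp_id]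
    rw [LinearMap.comp_assoc, ← LinearMap.comp_assoc _ (C.comulAux.rTensor C), e2,
      LinearMap.comp_assoc, h, ← LinearMap.comp_assoc C.comulAux, e3, LinearMap.comp_assoc, h,
      ← LinearMap.comp_assoc, ← LinearMap.comp_assoc, ← LinearMap.comp_assoc,
      LinearMap.comp_assoc (g := LinearMap.rTensor A _), Coalgebra.coassoc]
  rTensor_counit_comp_comul := by
    have hinj : Function.Injective (C.subtype.lTensor K) :=
      Module.Flat.lTensor_preserves_injective_linearMap _ C.subtype_injective
    rw [← LinearMap.cancel_left hinj, ← LinearMap.comp_assoc]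
    have e : C.subtype.lTensor K ∘ₗ (Coalgebra.counit (R := K) ∘ₗ C.subtype).rTensor C =
        (Coalgebra.counit (R := K)).rTensor A ∘ₗ TensorProduct.map C.subtype C.subtype := by
      ext; simp
    rw [e, LinearMap.comp_assoc, C.subtype₂_comp_comulAux, ← LinearMap.comp_assoc,
      Coalgebra.rTensor_counit_comp_comul]
    ext; simp
  lTensor_counit_comp_comul := by
    have hinj : Function.Injective (C.subtype.rTensor K) :=
      Module.Flat.rTensor_preserves_injective_linearMap _ C.subtype_injective
    rw [← LinearMap.cancel_left hinj, ← LinearMap.comp_assoc]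
    have e : C.subtype.rTensor K ∘ₗ (Coalgebra.counit (R := K) ∘ₗ C.subtype).lTensor C =
        (Coalgebra.counit (R := K)).lTensor A ∘ₗ TensorProduct.map C.subtype C.subtype := by
      ext; simp
    rw [e, LinearMap.comp_assoc, C.subtype₂_comp_comulAux, ← LinearMap.comp_assoc,
      Coalgebra.lTensor_counit_comp_comul]
    ext; simp

end Subcoalgebra

/-! ### Co-Frobenius coalgebras

The dual algebra `C* = Hom(C, K)` carries the convolution product
`(f * g)(c) = ∑ f(c₁) g(c₂)`; this is Mathlib's `WithConv (C →ₗ[K] K)`. -/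

section CoFrobenius

variable (K : Type*) (C : Type*) [Field K] [AddCommGroup C] [Module K C] [Coalgebra K C]

variable {K C} in
/-- The left `C*`-action on `C`: `f • c = ∑ f(c₂) c₁`. -/
def dualLeftAct (f : WithConv (C →ₗ[K] K)) : C →ₗ[K] C :=
  (TensorProduct.rid K C).toLinearMap ∘ₗ f.ofConv.lTensor C ∘ₗ Coalgebra.comul

variable {K C} in
/-- The right `C*`-action on `C`: `c • f = ∑ f(c₁) c₂`. -/
def dualRightAct (f : WithConv (C →ₗ[K] K)) : C →ₗ[K] C :=
  (TensorProduct.lid K C).toLinearMap ∘ₗ f.ofConv.rTensor C ∘ₗ Coalgebra.comul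

/-- `C` is left co-Frobenius: it embeds in `C*` as a left `C*`-module. -/
def IsLeftCoFrobenius : Prop :=
  ∃ φ : C →ₗ[K] WithConv (C →ₗ[K] K), Function.Injective φ ∧
    ∀ (f : WithConv (C →ₗ[K] K)) (c : C), φ (dualLeftAct f c) = f * φ c

/-- `C` is right co-Frobenius: it embeds in `C*` as a right `C*`-module. -/
def IsRightCoFrobenius : Prop :=
  ∃ φ : C →ₗ[K] WithConv (C →ₗ[K] K), Function.Injective φ ∧
    ∀ (f : WithConv (C →ₗ[K] K)) (c : C), φ (dualRightAct f c) = φ c * f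

end CoFrobenius

/-! ### The path coalgebra of a quiver -/

/-- The set of all paths (of length `≥ 0`) of a quiver. -/
abbrev QuiverPath (V : Type u) [Quiver.{v} V] : Type max u v := Σ a b : V, Quiver.Path a b

namespace QuiverPath

variable {V : Type u} [Quiver.{v} V]

/-- The length of a path. -/
def length (p : QuiverPath V) : ℕ := p.2.2.length

/-- All the factorizations `p = q r` of a path `p` from `a` to `b`, listed as triples `(c, q, r)`
with `q` a path from `a` to `c` and `r` a path from `c` to `b`. -/
def splits {a : V} : {b : V} → Quiver.Path a b → List (Σ c : V, Quiver.Path a c × Quiver.Path c b)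
  | _, .nil => [⟨a, .nil, .nil⟩]
  | b, .cons p e => ⟨b, .cons p e, .nil⟩ :: (splits p).map fun x => ⟨x.1, x.2.1, x.2.2.cons e⟩

theorem mem_splits {a b : V} (p : Quiver.Path a b)
    (x : Σ c : V, Quiver.Path a c × Quiver.Path c b) :
    x ∈ splits p ↔ x.2.1.comp x.2.2 = p := by
  induction p with
  | nil =>
    obtain ⟨c, q, r⟩ := x
    simp only [splits, List.mem_singleton]
    constructor
    · intro h; cases h; rfl
    · intro h
      cases r with
      | nil => cases q with
        | nil => rfl
        | cons q e => simp at h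
      | cons r e => simp at h
  | @cons b d p e ih =>
    obtain ⟨c, q, r⟩ := x
    simp only [splits, List.mem_cons, List.mem_map]
    constructor
    · rintro (h | ⟨y, hy, h⟩)
      · cases h; rfl
      · cases h
        have := (ih y).1 hy
        simp [this]
    · intro h
      cases r with
      | nil => left; simp at h; subst h; rfl
      | cons r e' =>
        right
        simp only [Quiver.Path.comp_cons] at h
        cases h
        exact ⟨⟨c, q, r⟩, (ih _).2 rfl, rfl⟩

theorem nodup_splits {a b : V} (p : Quiver.Path a b) : (splits p).Nodup := by
  induction p with
  | nil => simp [splits]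
  | cons p e ih =>
    rw [splits, List.nodup_cons]
    refine ⟨?_, ih.map ?_⟩
    · intro h
      obtain ⟨⟨c, q, r⟩, -, h⟩ := List.mem_map.1 h
      have h' := congrArg (fun z => z.2.2.length) h
      simp at h'
    · rintro ⟨c, q, r⟩ ⟨c', q', r'⟩ h
      cases h
      rfl

/-- Splitting a path into three pieces does not depend on the order of the cuts. -/
theorem sum_splits_splits {M : Type*} [AddCommMonoid M] {a b : V} (p : Quiver.Path a b) :
    ∀ F : (Σ c d : V, Quiver.Path a c × Quiver.Path c d × Quiver.Path d b) → M,
    ((splits p).map fun x => ((splits x.2.1).map fun y =>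
        F ⟨y.1, x.1, y.2.1, y.2.2, x.2.2⟩).sum).sum =
      ((splits p).map fun x => ((splits x.2.2).map fun y =>
        F ⟨x.1, y.1, x.2.1, y.2.1, y.2.2⟩).sum).sum := by
  induction p with
  | nil => intro F; simp [splits]
  | cons p e ih =>
    intro F
    have h := ih fun z => F ⟨z.1, z.2.1, z.2.2.1, z.2.2.2.1, z.2.2.2.2.cons e⟩
    simp only [splits, List.map_cons, List.sum_cons, List.map_map, Function.comp_def,
      List.map_nil, List.sum_nil, List.sum_map_add, add_zero]
    rw [h, add_assoc]

end QuiverPath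

/-- The underlying space of the path coalgebra `KΓ`: the vector space with basis all paths. -/
def PathCoalgebra (K : Type w) (V : Type u) [Field K] [Quiver.{v} V] : Type max u v w :=
  QuiverPath V →₀ K

namespace PathCoalgebra

variable (K : Type w) {V : Type u} [Field K] [Quiver.{v} V]

instance : AddCommGroup (PathCoalgebra K V) := inferInstanceAs (AddCommGroup (QuiverPath V →₀ K))

instance : Module K (PathCoalgebra K V) := inferInstanceAs (Module K (QuiverPath V →₀ K))

variable (V) in
/-- The basis of `KΓ` consisting of all paths. -/
def basis : Module.Basis (QuiverPath V) K (PathCoalgebra K V) :=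
  Module.Basis.ofRepr (LinearEquiv.refl K (QuiverPath V →₀ K))

/-- A path, viewed as an element of `KΓ`. -/
def ofPath {a b : V} (p : Quiver.Path a b) : PathCoalgebra K V := basis K V ⟨a, b, p⟩

/-- `Δ(p) = ∑_{q r = p} q ⊗ r`. -/
def comulPath {a b : V} (p : Quiver.Path a b) : PathCoalgebra K V ⊗[K] PathCoalgebra K V :=
  ((QuiverPath.splits p).map fun x => ofPath K x.2.1 ⊗ₜ[K] ofPath K x.2.2).sum

/-- `ε(v) = 1` for a vertex `v`, and `ε(p) = 0` for a path of positive length. -/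
def counitPath {a b : V} (p : Quiver.Path a b) : K := if p.length = 0 then 1 else 0

instance : CoalgebraStruct K (PathCoalgebra K V) where
  comul := (basis K V).constr K fun p => comulPath K p.2.2
  counit := (basis K V).constr K fun p => counitPath K p.2.2

theorem comul_ofPath {a b : V} (p : Quiver.Path a b) :
    Coalgebra.comul (R := K) (ofPath K p) = comulPath K p :=
  (basis K V).constr_basis K _ _

theorem counit_ofPath {a b : V} (p : Quiver.Path a b) :
    Coalgebra.counit (R := K) (ofPath K p) = counitPath K p :=
  (basis K V).constr_basis K _ _

theorem sum_counit_left {M : Type*} [AddCommGroup M] [Module K M] {a b : V}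
    (p : Quiver.Path a b) (F : (Σ c : V, Quiver.Path c b) → M) :
    ((QuiverPath.splits p).map fun x => counitPath K x.2.1 • F ⟨x.1, x.2.2⟩).sum = F ⟨a, p⟩ := by
  induction p with
  | nil => simp [QuiverPath.splits, counitPath]
  | cons p e ih =>
    have h := ih fun z => F ⟨z.1, z.2.cons e⟩
    simp only [QuiverPath.splits, List.map_cons, List.sum_cons, List.map_map, Function.comp_def, h]
    simp [counitPath]

theorem sum_counit_right {M : Type*} [AddCommGroup M] [Module K M] {a b : V}
    (p : Quiver.Path a b) (F : (Σ c : V, Quiver.Path a c) → M) :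
    ((QuiverPath.splits p).map fun x => counitPath K x.2.2 • F ⟨x.1, x.2.1⟩).sum = F ⟨b, p⟩ := by
  cases p with
  | nil => simp [QuiverPath.splits, counitPath]
  | cons p e =>
    simp only [QuiverPath.splits, List.map_cons, List.sum_cons, List.map_map, Function.comp_def]
    simp [counitPath]

/-- The path coalgebra `KΓ`. -/
instance instCoalgebra : Coalgebra K (PathCoalgebra K V) where
  coassoc := by
    refine (basis K V).ext fun ⟨a, b, p⟩ => ?_
    change TensorProduct.assoc K _ _ _ (LinearMap.rTensor _ _ (Coalgebra.comul (ofPath K p))) =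
      LinearMap.lTensor _ _ (Coalgebra.comul (ofPath K p))
    have h := QuiverPath.sum_splits_splits p fun z =>
      ofPath K z.2.2.1 ⊗ₜ[K] (ofPath K z.2.2.2.1 ⊗ₜ[K] ofPath K z.2.2.2.2)
    simp only [comul_ofPath, comulPath, map_list_sum, List.map_map, Function.comp_def,
      LinearMap.rTensor_tmul, LinearMap.lTensor_tmul]
    have hl (t : PathCoalgebra K V) (l : List (PathCoalgebra K V ⊗[K] PathCoalgebra K V)) :
        l.sum ⊗ₜ[K] t = (l.map fun s => s ⊗ₜ[K] t).sum :=
      map_list_sum ((TensorProduct.mk K _ _).flip t) l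
    have hr (t : PathCoalgebra K V) (l : List (PathCoalgebra K V ⊗[K] PathCoalgebra K V)) :
        t ⊗ₜ[K] l.sum = (l.map fun s => t ⊗ₜ[K] s).sum :=
      map_list_sum (TensorProduct.mk K _ _ t) l
    simpa only [hl, hr, map_list_sum, List.map_map, Function.comp_def,
      TensorProduct.assoc_tmul] using h
  rTensor_counit_comp_comul := by
    refine (basis K V).ext fun ⟨a, b, p⟩ => ?_
    change LinearMap.rTensor _ _ (Coalgebra.comul (ofPath K p)) = 1 ⊗ₜ[K] ofPath K p
    rw [← sum_counit_left K p fun z => (1 : K) ⊗ₜ[K] ofPath K z.2]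
    simp [comul_ofPath, comulPath, map_list_sum, Function.comp_def, counit_ofPath,
      TensorProduct.smul_tmul']
  lTensor_counit_comp_comul := by
    refine (basis K V).ext fun ⟨a, b, p⟩ => ?_
    change LinearMap.lTensor _ _ (Coalgebra.comul (ofPath K p)) = ofPath K p ⊗ₜ[K] 1
    rw [← sum_counit_right K p fun z => ofPath K z.2 ⊗ₜ[K] (1 : K)]
    simp [comul_ofPath, comulPath, map_list_sum, Function.comp_def, counit_ofPath,
      ← TensorProduct.tmul_smul]

variable {K} in
/-- A path subcoalgebra of `KΓ`: a subcoalgebra having a linear basis consisting of paths. -/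
def IsPathSubcoalgebra (C : Subcoalgebra K (PathCoalgebra K V)) : Prop :=
  ∃ (B : Set (QuiverPath V)) (b : Module.Basis B K C),
    ∀ p : B, (b p : PathCoalgebra K V) = basis K V p

variable (V) in
/-- The path subcoalgebra of `KΓ` spanned by all paths of length at most `s`. -/
def truncated (s : ℕ) : Subcoalgebra K (PathCoalgebra K V) where
  toSubmodule := Submodule.span K (basis K V '' {p | p.length ≤ s})
  comul_mem' := by
    set S := Submodule.span K (basis K V '' {p | p.length ≤ s}) with hS
    change S ≤ (LinearMap.range (TensorProduct.map S.subtype S.subtype)).comap Coalgebra.comul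
    rw [hS, Submodule.span_le, ← hS]
    rintro _ ⟨⟨a, b, p⟩, hp, rfl⟩
    change Coalgebra.comul (ofPath K p) ∈ LinearMap.range _
    rw [comul_ofPath]
    refine list_sum_mem fun y hy => ?_
    obtain ⟨⟨c, q, r⟩, hx, rfl⟩ := List.mem_map.1 hy
    have hl : q.length + r.length ≤ s := by
      have h := (QuiverPath.mem_splits p _).1 hx
      have h' : p.length ≤ s := hp
      rw [← h, Quiver.Path.length_comp] at h'
      exact h'
    have hq : ofPath K q ∈ S :=
      Submodule.subset_span ⟨⟨a, c, q⟩, le_trans (Nat.le_add_right _ _) hl, rfl⟩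
    have hr : ofPath K r ∈ S :=
      Submodule.subset_span ⟨⟨c, b, r⟩, le_trans (Nat.le_add_left _ _) hl, rfl⟩
    exact ⟨(⟨_, hq⟩ : S) ⊗ₜ[K] (⟨_, hr⟩ : S), rfl⟩

end PathCoalgebra

/-! ### The standard coalgebras -/

/-- The vertices of the quiver `𝔸_∞`: the integers. -/
def LineQuiver : Type := ℤ

/-- In `𝔸_∞` there is precisely one arrow `i ⟶ i + 1` for each `i`, and no other arrow. -/
instance : Quiver.{0} LineQuiver := ⟨fun i j : ℤ => PLift (j = i + 1)⟩

/-- The vertices of the quiver `ℂ_n`: the integers modulo `n`. -/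
def CycleQuiver (n : ℕ) : Type := ZMod n

/-- In `ℂ_n` there is precisely one arrow `i ⟶ i + 1` for each `i`, and no other arrow. For `n = 1`
this is one vertex with one loop. -/
instance (n : ℕ) : Quiver.{0} (CycleQuiver n) := ⟨fun i j : ZMod n => PLift (j = i + 1)⟩

/-- `K[𝔸_∞|s]`: spanned by the paths `p_{k,l}` of `𝔸_∞` with `k ≤ l ≤ r(k) = k + s`, that is,
by the paths of length at most `s`. -/
abbrev LineCoalgebra (K : Type w) [Field K] (s : ℕ) : Subcoalgebra K (PathCoalgebra K LineQuiver) :=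
  PathCoalgebra.truncated K LineQuiver s

/-- `K[ℂ_n, s]`: spanned by the paths of `ℂ_n` of length at most `s`. -/
abbrev CycleCoalgebra (K : Type w) [Field K] (n s : ℕ) :
    Subcoalgebra K (PathCoalgebra K (CycleQuiver n)) :=
  PathCoalgebra.truncated K (CycleQuiver n) s

/-- `D` is isomorphic, as a coalgebra, to `K[𝔸_∞|s]` with `s ≥ 1`, to `K[ℂ_n, s]` with `n, s ≥ 1`,
or to `K`. -/
def IsStandardCoFrobenius (K : Type w) (D : Type*) [Field K] [AddCommGroup D] [Module K D]
    [Coalgebra K D] : Prop :=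
  (∃ s : ℕ, 1 ≤ s ∧ Nonempty (D ≃ₗc[K] LineCoalgebra K s)) ∨
  (∃ n s : ℕ, 1 ≤ n ∧ 1 ≤ s ∧ Nonempty (D ≃ₗc[K] CycleCoalgebra K n s)) ∨
  Nonempty (D ≃ₗc[K] K)

end

/-! Let `B` be the set of paths forming the basis of `C`. Testing `Δ(qr)` against dual paths shows
that `B` contains every factor of its members.

A left embedding `φ` of `C` in `C*` is a pairing `φ(c)(d)`. For a vertex `a` in `B`, choose `d` in
`B` with `φ(a)(d) ≠ 0`. If `w` in `B` starts in `a`, its dual functional `w*` satisfies `w* • w =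
a`, so `(w* * φ(w))(d) ≠ 0` and `w` is a prefix of `d`. If `wd` lies in `B`, then `(w* * φ(a))(wd) =
φ(a)(d) ≠ 0`, so `w* • a ≠ 0` and `w` is trivial. A right embedding gives the mirror statement.
These two facts (`IsPathFamily.isBalanced`) are all that is used of the co-Frobenius conditions.

The rest is combinatorics. A vertex has at most one path in `B` of each length starting there, and
at most one ending there. The longest path from a vertex cannot be extended on either side, and its
length is the same at both ends of an arrow in `B` (`IsBalanced.length_eq_of_arrow`). Hence "follow
the arrow, or stay if there is none" permutes the vertices, and the maximal length `s` is constant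
on orbits. The paths starting in one orbit span a summand determined by `s` and the period `n` of
the orbit: trivial for `s = 0`, a line for an infinite orbit (`n = 0`), a cycle otherwise. -/

noncomputable section

open QuiverPath

/-! ### Families of paths in a coalgebra -/

section PathFamily

variable {V : Type u} [Quiver.{v} V]

/-- A set of paths that contains every factor of each of its members. -/
def FactorClosed (B : Set (QuiverPath V)) : Prop :=
  ∀ ⦃a b c : V⦄ (q : Quiver.Path a b) (r : Quiver.Path b c),
    (⟨a, c, q.comp r⟩ : QuiverPath V) ∈ B →
      (⟨a, b, q⟩ : QuiverPath V) ∈ B ∧ (⟨b, c, r⟩ : QuiverPath V) ∈ B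

/-- The restriction of `e` to the factor-closed set `B` is a basis of `D` on which the coalgebra
structure is that of the path coalgebra. -/
structure IsPathFamily (K : Type*) {D : Type*} [Field K] [AddCommGroup D] [Module K D]
    [Coalgebra K D] (B : Set (QuiverPath V)) (e : QuiverPath V → D) : Prop where
  closed : FactorClosed B
  linInd : LinearIndepOn K e B
  span_eq : Submodule.span K (e '' B) = ⊤
  comul_eq : ∀ ⦃a b : V⦄ (p : Quiver.Path a b), (⟨a, b, p⟩ : QuiverPath V) ∈ B →
    Coalgebra.comul (R := K) (e ⟨a, b, p⟩) =
      ((splits p).map fun x => e ⟨a, x.1, x.2.1⟩ ⊗ₜ[K] e ⟨x.1, b, x.2.2⟩).sum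
  counit_eq : ∀ ⦃a b : V⦄ (p : Quiver.Path a b), (⟨a, b, p⟩ : QuiverPath V) ∈ B →
    Coalgebra.counit (R := K) (e ⟨a, b, p⟩) = if p.length = 0 then 1 else 0

theorem isPathFamily_univ (K : Type*) [Field K] :
    IsPathFamily K Set.univ (PathCoalgebra.basis K V) where
  closed _ _ _ _ _ _ := ⟨trivial, trivial⟩
  linInd := (PathCoalgebra.basis K V).linearIndependent.linearIndepOn _
  span_eq := by rw [Set.image_univ, (PathCoalgebra.basis K V).span_eq]
  comul_eq _ _ p _ := PathCoalgebra.comul_ofPath K p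
  counit_eq _ _ p _ := PathCoalgebra.counit_ofPath K p

namespace IsPathFamily

variable {K : Type*} {D : Type*} [Field K] [AddCommGroup D] [Module K D] [Coalgebra K D]
  {B : Set (QuiverPath V)} {e : QuiverPath V → D}

/-- A subcoalgebra spanned by a factor-closed subfamily is a coalgebra of paths. -/
theorem exists_subcoalgebra (h : IsPathFamily K B e) (S : Subcoalgebra K D)
    {B' : Set (QuiverPath V)} (hB' : B' ⊆ B) (hc : FactorClosed B')
    (hS : S.toSubmodule = Submodule.span K (e '' B')) :
    ∃ e' : QuiverPath V → S, IsPathFamily K B' e' := by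
  classical
  have hmem : ∀ p ∈ B', e p ∈ S := fun p hp => by
    change e p ∈ S.toSubmodule
    rw [hS]; exact Submodule.subset_span ⟨p, hp, rfl⟩
  -- The value `0` off `B'` is irrelevant: the conditions concern members of `B'` and their factors,
  -- which lie in `B'` again.
  let e' : QuiverPath V → S := fun p => if hp : p ∈ B' then ⟨e p, hmem p hp⟩ else 0
  have he' : ∀ p ∈ B', S.subtype (e' p) = e p := fun p hp => by
    simp only [e', dif_pos hp]; rfl
  refine ⟨e', hc, ?_, ?_, ?_, ?_⟩
  · have h1 : LinearIndepOn K (S.subtype ∘ e') B' :=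
      (h.linInd.mono hB').congr fun p hp => (he' p hp).symm
    exact LinearIndependent.of_comp S.subtype h1
  · apply Submodule.map_injective_of_injective S.subtype_injective
    rw [Submodule.map_span, ← Set.image_comp, Submodule.map_top]
    have : (S.subtype ∘ e') '' B' = e '' B' := Set.image_congr he'
    have hr : LinearMap.range S.subtype = S.toSubmodule := Submodule.range_subtype _
    rw [hr, hS]
    exact congrArg _ this
  · intro a b p hp
    -- The comultiplication of `S` is known only through its image in `D ⊗ D`, so the comparison
    -- takes place there.
    apply S.subtype₂_injective
    have h1 : S.subtype₂ (Coalgebra.comul (R := K) (e' ⟨a, b, p⟩)) =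
        Coalgebra.comul (R := K) (S.subtype (e' ⟨a, b, p⟩)) :=
      LinearMap.congr_fun S.subtype₂_comp_comulAux _
    rw [h1, he' _ hp, h.comul_eq p (hB' hp), map_list_sum, List.map_map]
    congr 1
    refine List.map_congr_left fun x hx => ?_
    rw [mem_splits] at hx
    have h2 := hc x.2.1 x.2.2 (by rw [hx]; exact hp)
    simp only [Function.comp, Subcoalgebra.subtype₂, TensorProduct.map_tmul]
    rw [he' _ h2.1, he' _ h2.2]
  · intro a b p hp
    have h1 : Coalgebra.counit (R := K) (e' ⟨a, b, p⟩) =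
        Coalgebra.counit (R := K) (S.subtype (e' ⟨a, b, p⟩)) := rfl
    rw [h1, he' _ hp, h.counit_eq p (hB' hp)]

/-- The subcoalgebra spanned by a factor-closed subfamily. -/
def subcoalgebra (h : IsPathFamily K B e) (B' : Set (QuiverPath V)) (hB' : B' ⊆ B)
    (hc : FactorClosed B') : Subcoalgebra K D where
  toSubmodule := Submodule.span K (e '' B')
  comul_mem' := by
    set S := Submodule.span K (e '' B') with hS
    change S ≤ (LinearMap.range (TensorProduct.map S.subtype S.subtype)).comap Coalgebra.comul
    rw [hS, Submodule.span_le, ← hS]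
    rintro _ ⟨⟨a, b, p⟩, hp, rfl⟩
    change Coalgebra.comul (e ⟨a, b, p⟩) ∈ LinearMap.range _
    rw [h.comul_eq p (hB' hp)]
    refine list_sum_mem fun y hy => ?_
    obtain ⟨⟨c, q, r⟩, hx, rfl⟩ := List.mem_map.1 hy
    obtain ⟨h1, h2⟩ := hc q r (by rw [(mem_splits p _).1 hx]; exact hp)
    exact ⟨(⟨_, Submodule.subset_span ⟨_, h1, rfl⟩⟩ : S) ⊗ₜ[K]
      (⟨_, Submodule.subset_span ⟨_, h2, rfl⟩⟩ : S), rfl⟩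

/-- The basis underlying a path family. -/
def basis (h : IsPathFamily K B e) : Module.Basis B K D :=
  Module.Basis.mk (v := fun p : B => e p) h.linInd (by
    rw [← h.span_eq, Set.image_eq_range])

theorem basis_apply (h : IsPathFamily K B e) (p : B) : h.basis p = e p :=
  Module.Basis.mk_apply _ _ _

end IsPathFamily

theorem factorClosed_length_le (s : ℕ) : FactorClosed {p : QuiverPath V | p.length ≤ s} := by
  intro a b c q r h
  have h' : (q.comp r).length ≤ s := h
  rw [Quiver.Path.length_comp] at h'
  exact ⟨show q.length ≤ s by omega, show r.length ≤ s by omega⟩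

/-- The paths in a subcoalgebra spanned by paths are closed under factors. -/
theorem factorClosed_of_subcoalgebra {K : Type*} [Field K]
    (S : Subcoalgebra K (PathCoalgebra K V)) (B : Set (QuiverPath V))
    (hS : S.toSubmodule = Submodule.span K (PathCoalgebra.basis K V '' B)) : FactorClosed B := by
  classical
  set bs := PathCoalgebra.basis K V
  have hvanish : ∀ q, q ∉ B → ∀ x ∈ S.toSubmodule, bs.coord q x = 0 := by
    intro q hq x hx
    rw [hS] at hx
    induction hx using Submodule.span_induction with
    | mem x hx =>
      obtain ⟨p, hp, rfl⟩ := hx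
      rw [bs.coord_apply, bs.repr_self, Finsupp.single_eq_of_ne]
      rintro rfl; exact hq hp
    | zero => simp
    | add x y _ _ hx hy => rw [map_add, hx, hy, add_zero]
    | smul c x _ hx => rw [map_smul, hx, smul_zero]
  intro a b c q r hqr
  let Q : QuiverPath V := ⟨a, b, q⟩
  let R : QuiverPath V := ⟨b, c, r⟩
  let P : QuiverPath V := ⟨a, c, q.comp r⟩
  -- The functional `Q* ⊗ R*`. It is `1` on `Δ(qr)`, where only the factorization `(q, r)`
  -- contributes, but it kills `S ⊗ S` as soon as `Q` or `R` is missing from `B`.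
  let F := LinearMap.mul' K K ∘ₗ TensorProduct.map (bs.coord Q) (bs.coord R)
  have hF : F (Coalgebra.comul (R := K) (bs P)) = 1 := by
    have h1 : Coalgebra.comul (R := K) (bs P) = PathCoalgebra.comulPath K (q.comp r) :=
      PathCoalgebra.comul_ofPath K _
    rw [h1, PathCoalgebra.comulPath, map_list_sum, List.map_map]
    have h2 : (splits (q.comp r)).map (F ∘ fun x => PathCoalgebra.ofPath K x.2.1 ⊗ₜ[K]
        PathCoalgebra.ofPath K x.2.2) =
        (splits (q.comp r)).map fun x => if x = ⟨b, q, r⟩ then (1 : K) else 0 := by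
      refine List.map_congr_left fun x hx => ?_
      obtain ⟨d, y, z⟩ := x
      have h3 : F (PathCoalgebra.ofPath K y ⊗ₜ[K] PathCoalgebra.ofPath K z) =
        (if (⟨a, d, y⟩ : QuiverPath V) = Q then (1 : K) else 0) *
          (if (⟨d, c, z⟩ : QuiverPath V) = R then (1 : K) else 0) := by
        change bs.coord Q (bs _) * bs.coord R (bs _) = _
        simp only [bs.coord_apply, bs.repr_self, Finsupp.single_apply]
      refine h3.trans ?_
      by_cases hx : (⟨d, y, z⟩ : Σ d : V, Quiver.Path a d × Quiver.Path d c) = ⟨b, q, r⟩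
      · cases hx; simp [Q, R]
      · rw [if_neg hx]
        by_cases h4 : (⟨a, d, y⟩ : QuiverPath V) = Q
        · rw [if_neg (c := _ = R), mul_zero]
          intro h5
          simp only [Q, R] at h4 h5
          cases h4; cases h5; exact hx rfl
        · rw [if_neg h4, zero_mul]
    rw [h2, ← List.sum_toFinset _ (nodup_splits _), Finset.sum_ite_eq', if_pos]
    rw [List.mem_toFinset, mem_splits]
  have hP : bs P ∈ S.toSubmodule := by
    rw [hS]; exact Submodule.subset_span ⟨P, hqr, rfl⟩
  obtain ⟨t, ht⟩ := S.comul_mem' _ hP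
  rw [← ht] at hF
  have hzero : (Q ∉ B ∨ R ∉ B) → ∀ t, F (TensorProduct.map S.toSubmodule.subtype
      S.toSubmodule.subtype t) = 0 := by
    intro h t
    induction t with
    | zero => simp
    | add x y hx hy => rw [map_add, map_add, hx, hy, add_zero]
    | tmul x y =>
      change bs.coord Q x * bs.coord R y = 0
      rcases h with h | h
      · rw [hvanish Q h x x.2, zero_mul]
      · rw [hvanish R h y y.2, mul_zero]
  by_contra hcon
  rw [hzero (not_and_or.1 hcon)] at hF
  exact zero_ne_one hF

end PathFamily

/-! ### Coalgebras with a shift basis -/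

/-- `D` has a basis `b x k`, for `x ∈ ZMod n` and `k ≤ s`, that comultiplies like the path of length
`k` starting in `x` in the quiver with one arrow `x ⟶ x + 1` for each `x`. -/
def HasShiftBasis (K D : Type*) [Field K] [AddCommGroup D] [Module K D] [Coalgebra K D]
    (n s : ℕ) : Prop :=
  ∃ b : Module.Basis (ZMod n × Fin (s + 1)) K D, ∃ f : ZMod n → ℕ → D,
    (∀ x, b x = f x.1 x.2) ∧
    (∀ x, ∀ k ≤ s, Coalgebra.comul (R := K) (f x k) =
      ∑ i ∈ Finset.range (k + 1), f x i ⊗ₜ[K] f (x + i) (k - i)) ∧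
    ∀ x, ∀ k ≤ s, Coalgebra.counit (R := K) (f x k) = if k = 0 then 1 else 0

/-- The structure constants depend only on `n` and `s`, so matching the two bases is an isomorphism.
Identifying a component thus reduces to computing two numbers. -/
theorem HasShiftBasis.nonempty_coalgEquiv {K D E : Type*} [Field K] [AddCommGroup D] [Module K D]
    [Coalgebra K D] [AddCommGroup E] [Module K E] [Coalgebra K E] {n s : ℕ}
    (hD : HasShiftBasis K D n s) (hE : HasShiftBasis K E n s) : Nonempty (D ≃ₗc[K] E) := by
  obtain ⟨b, f, hb, hf, hf0⟩ := hD
  obtain ⟨c, g, hc, hg, hg0⟩ := hE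
  let φ : D ≃ₗ[K] E := b.equiv c (Equiv.refl _)
  have hφ : ∀ x, ∀ k ≤ s, φ (f x k) = g x k := by
    intro x k hk
    have h1 := hb (x, ⟨k, by omega⟩)
    have h2 := hc (x, ⟨k, by omega⟩)
    simp only at h1 h2
    rw [← h1, ← h2]
    simp [φ]
  refine ⟨{ φ with counit_comp := ?_, map_comp_comul := ?_ }⟩
  · refine b.ext fun x => ?_
    rw [hb]
    change Coalgebra.counit (φ (f x.1 x.2)) = _
    rw [hφ _ _ (by omega), hf0 _ _ (by omega), hg0 _ _ (by omega)]
  · refine b.ext fun x => ?_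
    rw [hb]
    change TensorProduct.map φ.toLinearMap φ.toLinearMap (Coalgebra.comul (f x.1 x.2)) =
      Coalgebra.comul (φ (f x.1 x.2))
    rw [hφ _ _ (by omega), hf _ _ (by omega), hg _ _ (by omega), map_sum]
    refine Finset.sum_congr rfl fun i hi => ?_
    rw [Finset.mem_range] at hi
    rw [TensorProduct.map_tmul]
    congr 1
    · exact hφ _ _ (by omega)
    · exact hφ _ _ (by omega)

/-- The trivial coalgebra. -/
theorem hasShiftBasis_trivial (K : Type*) [Field K] : HasShiftBasis K K 1 0 := by
  let _ : Unique (ZMod 1 × Fin (0 + 1)) :=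
    { default := (0, 0), uniq := fun _ => Subsingleton.elim (α := Fin 1 × Fin 1) _ _ }
  refine ⟨Module.Basis.singleton _ K, fun _ _ => 1, fun x => by simp, ?_, ?_⟩
  · intro x k hk
    obtain rfl : k = 0 := by omega
    simp
  · intro x k hk
    simp [Nat.le_zero.1 hk]

section

variable {V : Type u} [Quiver.{v} V]

/-- A path has exactly one factorization for each length of the first factor. -/
theorem sum_splits_eq_sum_range {M : Type*} [AddCommMonoid M] {a b : V} (p : Quiver.Path a b)
    (H : ℕ → M) : ((splits p).map fun x => H x.2.1.length).sum =
      ∑ i ∈ Finset.range (p.length + 1), H i := by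
  induction p with
  | nil => simp [splits]
  | cons p e ih =>
    simp only [splits, List.map_cons, List.sum_cons, List.map_map, Function.comp_def, ih]
    rw [Quiver.Path.length_cons, Finset.sum_range_succ _ (p.length + 1), add_comm]

/-- A coalgebra of paths has a shift basis if its paths are those of length at most `s` along a
sequence of vertices `v x`, for `x ∈ ZMod n`. -/
theorem IsPathFamily.hasShiftBasis {K D : Type*} [Field K] [AddCommGroup D] [Module K D]
    [Coalgebra K D] {B : Set (QuiverPath V)} {e : QuiverPath V → D} (h : IsPathFamily K B e)
    {n s : ℕ} (v : ZMod n → V) (hv : Function.Injective v)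
    (hex : ∀ x, ∀ k ≤ s, ∃ p ∈ B, p.1 = v x ∧ p.length = k)
    (huniq : ∀ p ∈ B, ∀ q ∈ B, p.1 = q.1 → p.length = q.length → p = q)
    (hB : ∀ p ∈ B, p.length ≤ s ∧ ∃ x : ZMod n, p.1 = v x ∧ p.2.1 = v (x + p.length)) :
    HasShiftBasis K D n s := by
  classical
  choose P hPB hP1 hPl using hex
  have hPeq : ∀ p ∈ B, ∀ x k (hk : k ≤ s), p.1 = v x → p.length = k → p = P x k hk :=
    fun p hp x k hk h1 h2 => huniq p hp _ (hPB x k hk) (by rw [h1, hP1]) (by rw [h2, hPl])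
  let g : ZMod n × Fin (s + 1) → B := fun x => ⟨P x.1 x.2 (by omega), hPB _ _ _⟩
  have hg : Function.Bijective g := by
    constructor
    · rintro ⟨x, i⟩ ⟨y, j⟩ hxy
      have h0 : P x i (by omega) = P y j (by omega) := congrArg Subtype.val hxy
      have h1 : v x = v y := by
        rw [← hP1 x i (by omega), ← hP1 y j (by omega), h0]
      have h2 : (i : ℕ) = j := by
        rw [← hPl x i (by omega), ← hPl y j (by omega), h0]
      rw [hv h1, Fin.ext h2]
    · rintro ⟨p, hp⟩
      obtain ⟨h1, x, h2, -⟩ := hB p hp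
      exact ⟨(x, ⟨p.length, by omega⟩), Subtype.ext (hPeq p hp _ _ _ h2 rfl).symm⟩
  refine ⟨h.basis.reindex (Equiv.ofBijective g hg).symm,
    -- Only lengths `k ≤ s` matter; the value `0` beyond them is never inspected.
    fun x k => if hk : k ≤ s then e (P x k hk) else 0, ?_, ?_, ?_⟩
  · intro x
    have hk : (x.2 : ℕ) ≤ s := by omega
    simp only [Module.Basis.reindex_apply, Equiv.symm_symm, Equiv.ofBijective_apply, dif_pos hk]
    exact h.basis_apply _
  · intro x k hk
    beta_reduce
    rw [dif_pos hk]
    have h1 := hPB x k hk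
    have h2 := hP1 x k hk
    have h3 := hPl x k hk
    generalize P x k hk = p at h1 h2 h3
    obtain ⟨a, b, p⟩ := p
    change a = v x at h2
    change p.length = k at h3
    rw [h.comul_eq p h1]
    subst h3
    rw [← sum_splits_eq_sum_range p]
    congr 1
    refine List.map_congr_left fun y hy => ?_
    obtain ⟨c, q, r⟩ := y
    rw [mem_splits] at hy
    dsimp only at hy ⊢
    subst hy
    obtain ⟨hq, hr⟩ := h.closed q r h1
    rw [Quiver.Path.length_comp] at hk ⊢
    have e1 : (⟨a, c, q⟩ : QuiverPath V) = P x q.length (by omega) := hPeq _ hq _ _ _ h2 rfl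
    have e2 : (⟨c, b, r⟩ : QuiverPath V) = P (x + q.length) (q.length + r.length - q.length)
        (by omega) := by
      -- The vertex where `r` starts is the end of `q`, which `hB` places `q.length` steps after
      -- `x`, injectivity of `v` identifying the index.
      refine hPeq _ hr _ _ _ ?_ (by simp [QuiverPath.length])
      obtain ⟨-, y, h4, h5⟩ := hB _ hq
      change a = v y at h4
      obtain rfl : y = x := hv (h4.symm.trans h2)
      exact h5
    rw [dif_pos (by omega), dif_pos (by omega), ← e1, ← e2]
  · intro x k hk
    beta_reduce
    rw [dif_pos hk]
    have h3 := hPl x k hk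
    have h1 := hPB x k hk
    generalize P x k hk = p at h3 h1
    rw [h.counit_eq p.2.2 h1, ← h3]
    rfl

/-- The truncated path coalgebra of the quiver on `ZMod n` with arrows `x ⟶ x + 1`. -/
theorem hasShiftBasis_truncated (K : Type*) [Field K] {n : ℕ} (s : ℕ) (v : ZMod n ≃ V)
    (hsub : ∀ x y : V, Subsingleton (x ⟶ y))
    (hhom : ∀ x y, Nonempty (v x ⟶ v y) ↔ y = x + 1) :
    HasShiftBasis K (PathCoalgebra.truncated K V s) n s := by
  obtain ⟨e, he⟩ := (isPathFamily_univ (V := V) K).exists_subcoalgebra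
    (PathCoalgebra.truncated K V s) (Set.subset_univ _) (factorClosed_length_le s) rfl
  have hend : ∀ {a b : V} (p : Quiver.Path a b), v.symm b = v.symm a + p.length := by
    intro a b p
    induction p with
    | nil => simp
    | @cons b c p f ih =>
      have := (hhom (v.symm b) (v.symm c)).1 ⟨by simpa using f⟩
      rw [this, ih, Quiver.Path.length_cons]; push_cast; ring
  have hpuniq : ∀ {a b : V} (p : Quiver.Path a b) {b' : V} (q : Quiver.Path a b'),
      p.length = q.length → (⟨a, b, p⟩ : QuiverPath V) = ⟨a, b', q⟩ := by
    intro a b p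
    induction p with
    | nil =>
      intro b' q hq
      cases q with
      | nil => rfl
      | cons q f => simp at hq
    | @cons b c p f ih =>
      intro b' q hq
      cases q with
      | nil => simp at hq
      | @cons b₁ _ q g =>
        have h1 := ih q (by simpa using hq)
        cases h1
        have h2 := (hhom (v.symm b) (v.symm c)).1 ⟨by simpa using f⟩
        have h3 := (hhom (v.symm b) (v.symm b')).1 ⟨by simpa using g⟩
        obtain rfl : c = b' := v.symm.injective (h2.trans h3.symm)
        obtain rfl : f = g := (hsub _ _).elim _ _
        rfl
  refine he.hasShiftBasis v v.injective ?_ ?_ ?_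
  · intro x k hk
    have : ∃ b, ∃ p : Quiver.Path (v x) b, p.length = k := by
      clear hk
      induction k with
      | zero => exact ⟨_, .nil, rfl⟩
      | succ k ih =>
        obtain ⟨b, p, hp⟩ := ih
        obtain ⟨f⟩ := (hhom (v.symm b) (v.symm b + 1)).2 rfl
        rw [v.apply_symm_apply] at f
        exact ⟨_, p.cons f, by simp [hp]⟩
    obtain ⟨b, p, hp⟩ := this
    exact ⟨⟨_, b, p⟩, hp.le.trans hk, rfl, hp⟩
  · rintro ⟨a, b, p⟩ - ⟨a', b', q⟩ - h1 h2
    obtain rfl : a = a' := h1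
    exact hpuniq p q h2
  · rintro ⟨a, b, p⟩ hp
    exact ⟨hp, v.symm a, by simp, (v.symm_apply_eq).1 (hend p)⟩

end

/-- `ZMod 0` is `ℤ` by definition, so the line is the case `n = 0`. This agrees with
`Function.minimalPeriod`, which is `0` on an infinite orbit. -/
theorem hasShiftBasis_line (K : Type w) [Field K] (s : ℕ) :
    HasShiftBasis K (LineCoalgebra K s) 0 s :=
  hasShiftBasis_truncated K s (Equiv.refl ℤ)
    (fun (x y : ℤ) => inferInstanceAs (Subsingleton (PLift (y = x + 1))))
    (fun _ _ => ⟨fun ⟨h⟩ => h.down, fun h => ⟨⟨h⟩⟩⟩)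

theorem hasShiftBasis_cycle (K : Type w) [Field K] (n s : ℕ) :
    HasShiftBasis K (CycleCoalgebra K n s) n s :=
  hasShiftBasis_truncated K s (Equiv.refl (ZMod n))
    (fun (x y : ZMod n) => inferInstanceAs (Subsingleton (PLift (y = x + 1))))
    (fun _ _ => ⟨fun ⟨h⟩ => h.down, fun h => ⟨⟨h⟩⟩⟩)

/-! ### Paths in a co-Frobenius coalgebra -/

section CoFrobeniusPaths

variable {V : Type u} [Quiver.{v} V]

theorem sum_splits_eq_single {M : Type*} [AddCommMonoid M] {a b c : V} {p : Quiver.Path a c}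
    (F : (Σ b : V, Quiver.Path a b × Quiver.Path b c) → M) (q : Quiver.Path a b)
    (r : Quiver.Path b c) (hqr : q.comp r = p)
    (hF : ∀ x : (Σ b : V, Quiver.Path a b × Quiver.Path b c), x.2.1.comp x.2.2 = p →
      x ≠ ⟨b, q, r⟩ → F x = 0) :
    ((splits p).map F).sum = F ⟨b, q, r⟩ := by
  classical
  rw [← List.sum_toFinset _ (nodup_splits p)]
  refine Finset.sum_eq_single _ (fun x hx hne => hF x ?_ hne) (fun h => (h ?_).elim)
  · rwa [List.mem_toFinset, mem_splits] at hx
  · rw [List.mem_toFinset, mem_splits]; exact hqr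

theorem exists_splits_ne_zero {M : Type*} [AddCommMonoid M] {a c : V} {p : Quiver.Path a c}
    (F : (Σ b : V, Quiver.Path a b × Quiver.Path b c) → M) (h : ((splits p).map F).sum ≠ 0) :
    ∃ x : (Σ b : V, Quiver.Path a b × Quiver.Path b c), x.2.1.comp x.2.2 = p ∧ F x ≠ 0 := by
  by_contra! hcon
  refine h (List.sum_eq_zero fun y hy => ?_)
  obtain ⟨x, hx, rfl⟩ := List.mem_map.1 hy
  exact hcon x ((mem_splits _ _).1 hx)

/-- Two factorizations of a path whose first factors have the same length coincide. -/
theorem factorization_ext {a b b' c : V} (p : Quiver.Path a b) (y : Quiver.Path b c)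
    (q : Quiver.Path a b') (z : Quiver.Path b' c) (h : p.comp y = q.comp z)
    (hl : p.length = q.length) :
    (⟨b, p, y⟩ : Σ b : V, Quiver.Path a b × Quiver.Path b c) = ⟨b', q, z⟩ := by
  have hl' : y.length = z.length := by
    have := congrArg Quiver.Path.length h
    simp only [Quiver.Path.length_comp] at this
    omega
  clear hl
  induction y with
  | nil =>
    cases z with
    | nil => cases h; rfl
    | cons => simp at hl'
  | cons y f ih =>
    cases z with
    | nil => simp at hl'
    | cons z g =>
      simp only [Quiver.Path.comp_cons] at h
      obtain rfl := Quiver.Path.obj_eq_of_cons_eq_cons h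
      have h1 := eq_of_heq (Quiver.Path.heq_of_cons_eq_cons h)
      obtain rfl := eq_of_heq (Quiver.Path.hom_heq_of_cons_eq_cons h)
      have h2 := ih z h1 (by simpa using hl')
      cases h2
      rfl

theorem exists_factorization {a c : V} (p : Quiver.Path a c) (k : ℕ) (hk : k ≤ p.length) :
    ∃ (b : V) (q : Quiver.Path a b) (r : Quiver.Path b c), q.comp r = p ∧ q.length = k := by
  induction p with
  | nil => exact ⟨_, .nil, .nil, rfl, by simpa [eq_comm] using hk⟩
  | cons p f ih =>
    rcases hk.lt_or_eq with hk | rfl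
    · obtain ⟨b, q, r, rfl, h⟩ := ih (by simpa [Nat.lt_succ_iff] using hk)
      exact ⟨b, q, r.cons f, rfl, h⟩
    · exact ⟨_, p.cons f, .nil, rfl, rfl⟩

/-- The paths of a left and right co-Frobenius path coalgebra: for each vertex `a` there is a path
that extends every path starting in `a` and cannot be extended on the left, and a path that extends
every path ending in `a` and cannot be extended on the right. -/
structure IsBalanced (B : Set (QuiverPath V)) : Prop where
  closed : FactorClosed B
  left : ∀ a : V, (⟨a, a, .nil⟩ : QuiverPath V) ∈ B → ∃ (b : V) (d : Quiver.Path a b),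
    (⟨a, b, d⟩ : QuiverPath V) ∈ B ∧
    (∀ (c : V) (w : Quiver.Path a c), (⟨a, c, w⟩ : QuiverPath V) ∈ B →
      ∃ y : Quiver.Path c b, w.comp y = d) ∧
    ∀ (c : V) (w : Quiver.Path c a), (⟨c, b, w.comp d⟩ : QuiverPath V) ∈ B → w.length = 0
  right : ∀ a : V, (⟨a, a, .nil⟩ : QuiverPath V) ∈ B → ∃ (b : V) (d : Quiver.Path b a),
    (⟨b, a, d⟩ : QuiverPath V) ∈ B ∧
    (∀ (c : V) (w : Quiver.Path c a), (⟨c, a, w⟩ : QuiverPath V) ∈ B →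
      ∃ y : Quiver.Path b c, y.comp w = d) ∧
    ∀ (c : V) (w : Quiver.Path a c), (⟨b, c, d.comp w⟩ : QuiverPath V) ∈ B → w.length = 0

/-! ### The pairing given by a co-Frobenius embedding -/

namespace IsPathFamily

variable {K : Type*} {D : Type*} [Field K] [AddCommGroup D] [Module K D] [Coalgebra K D]
  {B : Set (QuiverPath V)} {e : QuiverPath V → D}

/-- This is the module identity `φ(f • p) = f * φ(p)` evaluated at `d`, with both comultiplications
expanded. Taking `f` dual to a path isolates single factorizations. -/
theorem comul_left (h : IsPathFamily K B e) {φ : D →ₗ[K] WithConv (D →ₗ[K] K)}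
    (hφ : ∀ (f : WithConv (D →ₗ[K] K)) (c : D), φ (dualLeftAct f c) = f * φ c)
    (f : D →ₗ[K] K) {a b a' b' : V} {p : Quiver.Path a b} (hp : (⟨a, b, p⟩ : QuiverPath V) ∈ B)
    {d : Quiver.Path a' b'} (hd : (⟨a', b', d⟩ : QuiverPath V) ∈ B) :
    ((splits p).map fun x => f (e ⟨x.1, b, x.2.2⟩) *
        (φ (e ⟨a, x.1, x.2.1⟩)).ofConv (e ⟨a', b', d⟩)).sum =
      ((splits d).map fun x => f (e ⟨a', x.1, x.2.1⟩) *
        (φ (e ⟨a, b, p⟩)).ofConv (e ⟨x.1, b', x.2.2⟩)).sum := by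
  let ev : WithConv (D →ₗ[K] K) →ₗ[K] K :=
    LinearMap.applyₗ (e ⟨a', b', d⟩) ∘ₗ (WithConv.linearEquiv K (D →ₗ[K] K)).toLinearMap
  have h2 : ((splits p).map fun x => f (e ⟨x.1, b, x.2.2⟩) *
        (φ (e ⟨a, x.1, x.2.1⟩)).ofConv (e ⟨a', b', d⟩)).sum =
      ev (φ (dualLeftAct (WithConv.toConv f) (e ⟨a, b, p⟩))) := by
    simp [dualLeftAct, h.comul_eq p hp, map_list_sum, Function.comp_def, ev]
  have h3 : ((splits d).map fun x => f (e ⟨a', x.1, x.2.1⟩) *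
        (φ (e ⟨a, b, p⟩)).ofConv (e ⟨x.1, b', x.2.2⟩)).sum =
      ev (WithConv.toConv f * φ (e ⟨a, b, p⟩)) := by
    change _ = (WithConv.toConv f * φ (e ⟨a, b, p⟩)).ofConv (e ⟨a', b', d⟩)
    simp [LinearMap.convMul_def, h.comul_eq d hd, map_list_sum, Function.comp_def]
  rw [h2, h3, hφ]

theorem comul_right (h : IsPathFamily K B e) {φ : D →ₗ[K] WithConv (D →ₗ[K] K)}
    (hφ : ∀ (f : WithConv (D →ₗ[K] K)) (c : D), φ (dualRightAct f c) = φ c * f)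
    (f : D →ₗ[K] K) {a b a' b' : V} {p : Quiver.Path a b} (hp : (⟨a, b, p⟩ : QuiverPath V) ∈ B)
    {d : Quiver.Path a' b'} (hd : (⟨a', b', d⟩ : QuiverPath V) ∈ B) :
    ((splits p).map fun x => f (e ⟨a, x.1, x.2.1⟩) *
        (φ (e ⟨x.1, b, x.2.2⟩)).ofConv (e ⟨a', b', d⟩)).sum =
      ((splits d).map fun x => (φ (e ⟨a, b, p⟩)).ofConv (e ⟨a', x.1, x.2.1⟩) *
        f (e ⟨x.1, b', x.2.2⟩)).sum := by
  let ev : WithConv (D →ₗ[K] K) →ₗ[K] K :=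
    LinearMap.applyₗ (e ⟨a', b', d⟩) ∘ₗ (WithConv.linearEquiv K (D →ₗ[K] K)).toLinearMap
  have h2 : ((splits p).map fun x => f (e ⟨a, x.1, x.2.1⟩) *
        (φ (e ⟨x.1, b, x.2.2⟩)).ofConv (e ⟨a', b', d⟩)).sum =
      ev (φ (dualRightAct (WithConv.toConv f) (e ⟨a, b, p⟩))) := by
    simp [dualRightAct, h.comul_eq p hp, map_list_sum, Function.comp_def, ev]
  have h3 : ((splits d).map fun x => (φ (e ⟨a, b, p⟩)).ofConv (e ⟨a', x.1, x.2.1⟩) *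
        f (e ⟨x.1, b', x.2.2⟩)).sum =
      ev (φ (e ⟨a, b, p⟩) * WithConv.toConv f) := by
    change _ = (φ (e ⟨a, b, p⟩) * WithConv.toConv f).ofConv (e ⟨a', b', d⟩)
    simp [LinearMap.convMul_def, h.comul_eq d hd, map_list_sum, Function.comp_def]
  rw [h2, h3, hφ]

theorem exists_coord (h : IsPathFamily K B e) {w : QuiverPath V} (hw : w ∈ B) :
    ∃ f : D →ₗ[K] K, f (e w) = 1 ∧ ∀ p ∈ B, f (e p) ≠ 0 → p = w := by
  refine ⟨h.basis.coord ⟨w, hw⟩, ?_, fun p hp hne => ?_⟩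
  · rw [← h.basis_apply ⟨w, hw⟩, Module.Basis.coord_apply, Module.Basis.repr_self,
      Finsupp.single_eq_same]
  · by_contra hpw
    rw [← h.basis_apply ⟨p, hp⟩, Module.Basis.coord_apply, Module.Basis.repr_self,
      Finsupp.single_eq_of_ne] at hne
    · exact hne rfl
    · intro h'; exact hpw (congrArg Subtype.val h').symm

/-- The only place where injectivity of the embedding enters. -/
theorem exists_pairing_ne_zero (h : IsPathFamily K B e) {φ : D →ₗ[K] WithConv (D →ₗ[K] K)}
    (hφ : Function.Injective φ) {p : QuiverPath V} (hp : p ∈ B) :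
    ∃ d ∈ B, (φ (e p)).ofConv (e d) ≠ 0 := by
  by_contra! hcon
  have h1 : (φ (e p)).ofConv = 0 := h.basis.ext fun d => by
    rw [h.basis_apply]; exact hcon d d.2
  have h2 : φ (e p) = 0 := congrArg WithConv.toConv h1
  rw [map_eq_zero_iff φ hφ, ← h.basis_apply ⟨p, hp⟩] at h2
  exact h.basis.ne_zero _ h2

theorem isBalanced (h : IsPathFamily K B e) (hl : IsLeftCoFrobenius K D)
    (hr : IsRightCoFrobenius K D) : IsBalanced B where
  closed := h.closed
  left a ha := by
    obtain ⟨φ, hinj, hφ⟩ := hl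
    obtain ⟨⟨a', b, d⟩, hd, hne⟩ := h.exists_pairing_ne_zero hinj ha
    -- With `f = w*`, the left side of `comul_left` for `w` and `d` collapses to `φ(a)(d) ≠ 0`, so
    -- some term on the right survives: `d` has a factorization beginning with `w`.
    have key : ∀ (c : V) (w : Quiver.Path a c), (⟨a, c, w⟩ : QuiverPath V) ∈ B →
        ∃ x : (Σ c : V, Quiver.Path a' c × Quiver.Path c b), x.2.1.comp x.2.2 = d ∧
          (⟨a', x.1, x.2.1⟩ : QuiverPath V) = ⟨a, c, w⟩ := by
      intro c w hw
      obtain ⟨f, hf1, hf⟩ := h.exists_coord hw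
      have h1 := h.comul_left hφ f hw hd
      rw [sum_splits_eq_single _ .nil w (Quiver.Path.nil_comp w), hf1, one_mul] at h1
      · rw [h1] at hne
        obtain ⟨x, hx, hx'⟩ := exists_splits_ne_zero _ hne
        exact ⟨x, hx, hf _ (h.closed _ _ (by rw [hx]; exact hd)).1 (left_ne_zero_of_mul hx')⟩
      · rintro ⟨b', y, z⟩ hx hne'
        by_contra hx'
        have h2 := hf _ (h.closed _ _ (by rw [hx]; exact hw)).2 (left_ne_zero_of_mul hx')
        dsimp only at h2
        cases h2
        refine hne' ?_
        have h3 := congrArg Quiver.Path.length hx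
        simp only [Quiver.Path.length_comp] at h3
        rw [y.eq_nil_of_length_zero (by omega)]
    -- Applied to the trivial path, `key` shows that `d` starts in `a`.
    obtain ⟨x, -, hx⟩ := key a .nil ha
    obtain rfl : a' = a := congrArg Sigma.fst hx
    refine ⟨b, d, hd, ?_, ?_⟩
    · intro c w hw
      obtain ⟨⟨c', y, z⟩, h1, h2⟩ := key c w hw
      cases h2
      exact ⟨z, h1⟩
    · intro c w hw
      obtain ⟨f, hf1, hf⟩ := h.exists_coord (h.closed _ _ hw).1
      -- Here the identity is evaluated at `wd`: the right side is `φ(a)(d) ≠ 0`, the left side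
      -- `w*(a) φ(a)(wd)`, so `w` must be the trivial path.
      have h1 := h.comul_left hφ f ha hw
      rw [sum_splits_eq_single (p := w.comp d) _ w d rfl, hf1, one_mul] at h1
      · simp only [splits, List.map_cons, List.map_nil, List.sum_cons, List.sum_nil, add_zero] at h1
        rw [← h1] at hne
        have h2 := hf _ ha (left_ne_zero_of_mul hne)
        cases h2
        rfl
      · rintro ⟨b', y, z⟩ hx hne'
        by_contra hx'
        have h2 := hf _ (h.closed _ _ (by rw [hx]; exact hw)).1 (left_ne_zero_of_mul hx')
        dsimp only at h2
        cases h2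
        exact hne' (factorization_ext _ _ _ _ hx rfl)
  right a ha := by
    obtain ⟨φ, hinj, hφ⟩ := hr
    obtain ⟨⟨b, a', d⟩, hd, hne⟩ := h.exists_pairing_ne_zero hinj ha
    -- Mirror image: under the right action `w • w*` is the end vertex of `w`, so `w` appears as a
    -- second factor of `d`.
    have key : ∀ (c : V) (w : Quiver.Path c a), (⟨c, a, w⟩ : QuiverPath V) ∈ B →
        ∃ x : (Σ c : V, Quiver.Path b c × Quiver.Path c a'), x.2.1.comp x.2.2 = d ∧
          (⟨x.1, a', x.2.2⟩ : QuiverPath V) = ⟨c, a, w⟩ := by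
      intro c w hw
      obtain ⟨f, hf1, hf⟩ := h.exists_coord hw
      have h1 := h.comul_right hφ f hw hd
      rw [sum_splits_eq_single _ w .nil (Quiver.Path.comp_nil w), hf1, one_mul] at h1
      · rw [h1] at hne
        obtain ⟨x, hx, hx'⟩ := exists_splits_ne_zero _ hne
        exact ⟨x, hx, hf _ (h.closed _ _ (by rw [hx]; exact hd)).2 (right_ne_zero_of_mul hx')⟩
      · rintro ⟨b', y, z⟩ hx hne'
        by_contra hx'
        have h2 := hf _ (h.closed _ _ (by rw [hx]; exact hw)).1 (left_ne_zero_of_mul hx')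
        dsimp only at h2
        cases h2
        exact hne' (factorization_ext _ _ _ _ hx rfl)
    obtain ⟨x, -, hx⟩ := key a .nil ha
    obtain rfl : a' = a := congrArg (fun p : QuiverPath V => p.2.1) hx
    refine ⟨b, d, hd, ?_, ?_⟩
    · intro c w hw
      obtain ⟨⟨c', y, z⟩, h1, h2⟩ := key c w hw
      cases h2
      exact ⟨y, h1⟩
    · intro c w hw
      obtain ⟨f, hf1, hf⟩ := h.exists_coord (h.closed _ _ hw).2
      have h1 := h.comul_right hφ f ha hw
      rw [sum_splits_eq_single (p := d.comp w) _ d w rfl, hf1, mul_one] at h1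
      · simp only [splits, List.map_cons, List.map_nil, List.sum_cons, List.sum_nil, add_zero] at h1
        rw [← h1] at hne
        have h2 := hf _ ha (left_ne_zero_of_mul hne)
        cases h2
        rfl
      · rintro ⟨b', y, z⟩ hx hne'
        by_contra hx'
        have h2 := hf _ (h.closed _ _ (by rw [hx]; exact hw)).2 (right_ne_zero_of_mul hx')
        dsimp only at h2
        cases h2
        have h3 := congrArg Quiver.Path.length hx
        simp only [Quiver.Path.length_comp] at h3
        exact hne' (factorization_ext _ _ _ _ hx (by omega))

end IsPathFamily

end CoFrobeniusPaths

/-! ### Combinatorics of balanced sets of paths -/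

namespace IsBalanced

variable {V : Type u} [Quiver.{v} V] {B : Set (QuiverPath V)}

theorem nil_left (h : IsBalanced B) {p : QuiverPath V} (hp : p ∈ B) :
    (⟨p.1, p.1, .nil⟩ : QuiverPath V) ∈ B :=
  (h.closed .nil p.2.2 (by rw [Quiver.Path.nil_comp]; exact hp)).1

theorem nil_right (h : IsBalanced B) {p : QuiverPath V} (hp : p ∈ B) :
    (⟨p.2.1, p.2.1, .nil⟩ : QuiverPath V) ∈ B :=
  (h.closed p.2.2 .nil hp).2

/-- Both paths are prefixes of the single path `d` supplied by `IsBalanced.left`, and a prefix is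
determined by its length. -/
theorem ext_left (h : IsBalanced B) {p q : QuiverPath V} (hp : p ∈ B) (hq : q ∈ B)
    (h1 : p.1 = q.1) (hl : p.length = q.length) : p = q := by
  obtain ⟨a, b, p⟩ := p
  obtain ⟨a', b', q⟩ := q
  obtain rfl : a = a' := h1
  obtain ⟨c, d, -, hd, -⟩ := h.left a (h.nil_left hp)
  obtain ⟨y, hy⟩ := hd _ p hp
  obtain ⟨z, hz⟩ := hd _ q hq
  cases factorization_ext p y q z (hy.trans hz.symm) hl
  rfl

theorem ext_right (h : IsBalanced B) {p q : QuiverPath V} (hp : p ∈ B) (hq : q ∈ B)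
    (h1 : p.2.1 = q.2.1) (hl : p.length = q.length) : p = q := by
  obtain ⟨a, b, p⟩ := p
  obtain ⟨a', b', q⟩ := q
  obtain rfl : b = b' := h1
  obtain ⟨c, d, -, hd, -⟩ := h.right b (h.nil_right hp)
  obtain ⟨y, hy⟩ := hd _ p hp
  obtain ⟨z, hz⟩ := hd _ q hq
  have hl' : p.length = q.length := hl
  have h2 := congrArg Quiver.Path.length (hy.trans hz.symm)
  simp only [Quiver.Path.length_comp] at h2
  cases factorization_ext y p z q (hy.trans hz.symm) (by omega)
  rfl

/-! ### Bimaximal paths -/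

/-- A path in `B` all of whose extensions in `B`, on both sides, are trivial. -/
structure _root_.IsBimaximal (B : Set (QuiverPath V)) {a b : V} (m : Quiver.Path a b) : Prop where
  mem : (⟨a, b, m⟩ : QuiverPath V) ∈ B
  left : ∀ (c : V) (w : Quiver.Path c a), (⟨c, b, w.comp m⟩ : QuiverPath V) ∈ B → w.length = 0
  right : ∀ (c : V) (w : Quiver.Path b c), (⟨a, c, m.comp w⟩ : QuiverPath V) ∈ B → w.length = 0

/-- The path `d` of `IsBalanced.left` also admits no right extension `dw`, since such a path would
start in `a` and be a prefix of `d`. -/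
theorem exists_bimaximal_from (h : IsBalanced B) {a : V} (ha : (⟨a, a, .nil⟩ : QuiverPath V) ∈ B) :
    ∃ (b : V) (m : Quiver.Path a b), IsBimaximal B m := by
  obtain ⟨b, d, hd, h1, h2⟩ := h.left a ha
  refine ⟨b, d, hd, h2, fun c w hw => ?_⟩
  obtain ⟨y, hy⟩ := h1 c _ hw
  have := congrArg Quiver.Path.length hy
  simp only [Quiver.Path.length_comp] at this
  omega

theorem exists_bimaximal_to (h : IsBalanced B) {a : V} (ha : (⟨a, a, .nil⟩ : QuiverPath V) ∈ B) :
    ∃ (b : V) (m : Quiver.Path b a), IsBimaximal B m := by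
  obtain ⟨b, d, hd, h1, h2⟩ := h.right a ha
  refine ⟨b, d, hd, fun c w hw => ?_, h2⟩
  obtain ⟨y, hy⟩ := h1 c _ hw
  have := congrArg Quiver.Path.length hy
  simp only [Quiver.Path.length_comp] at this
  omega

/-- Since `m` is a prefix of the path `d` of `IsBalanced.left` and has no proper right extension, `m
= d`. -/
theorem exists_comp_eq (h : IsBalanced B) {a b c : V} {m : Quiver.Path a b} (hm : IsBimaximal B m)
    {p : Quiver.Path a c} (hp : (⟨a, c, p⟩ : QuiverPath V) ∈ B) :
    ∃ y : Quiver.Path c b, p.comp y = m := by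
  obtain ⟨b', d, hd, h1, -⟩ := h.left a (h.nil_left hp)
  obtain ⟨y, hy⟩ := h1 _ p hp
  obtain ⟨z, hz⟩ := h1 _ m hm.mem
  have hz0 := hm.right _ z (by rw [hz]; exact hd)
  cases z with
  | nil => exact ⟨y, hy.trans hz.symm⟩
  | cons => simp at hz0

theorem exists_comp_eq' (h : IsBalanced B) {a b c : V} {m : Quiver.Path a b}
    (hm : IsBimaximal B m) {p : Quiver.Path c b} (hp : (⟨c, b, p⟩ : QuiverPath V) ∈ B) :
    ∃ y : Quiver.Path a c, y.comp p = m := by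
  obtain ⟨b', d, hd, h1, -⟩ := h.right b (h.nil_right hp)
  obtain ⟨y, hy⟩ := h1 _ p hp
  obtain ⟨z, hz⟩ := h1 _ m hm.mem
  have hz0 := hm.left _ z (by rw [hz]; exact hd)
  cases z with
  | nil => exact ⟨y, hy.trans (hz.symm.trans (Quiver.Path.nil_comp m))⟩
  | cons => simp at hz0

/-- Write `m = fy`; then `y` is a prefix of `m'`, and the claim is that `m'` is `y` followed by
exactly one arrow. At least one, because `fy` lies in `B` while `m'` has no left extension; at most
one, because `y` with its next arrow `g` is already bimaximal. -/
theorem length_eq_of_arrow (h : IsBalanced B) {a a' b b' : V} {f : Quiver.Path a a'}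
    (hf : (⟨a, a', f⟩ : QuiverPath V) ∈ B) (hf1 : f.length = 1) {m : Quiver.Path a b}
    (hm : IsBimaximal B m) {m' : Quiver.Path a' b'} (hm' : IsBimaximal B m') :
    m'.length = m.length := by
  obtain ⟨y, rfl⟩ := h.exists_comp_eq hm hf
  obtain ⟨z, rfl⟩ := h.exists_comp_eq hm' (h.closed _ _ hm.mem).2
  have hz : z.length ≠ 0 := by
    intro hz
    cases z with
    | nil => have := hm'.left _ f hm.mem; omega
    | cons => simp at hz
  obtain ⟨c, g, z, rfl, hg⟩ := exists_factorization z 1 (by omega)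
  rw [← Quiver.Path.comp_assoc] at hm'
  have hyg := (h.closed _ _ hm'.mem).1
  obtain ⟨c', n, hn⟩ := h.exists_bimaximal_to (h.nil_right hyg)
  obtain ⟨t, rfl⟩ := h.exists_comp_eq' hn hyg
  -- Otherwise the last arrow of `t` ends where `f` does, hence equals `f`, and `fyg` in `B`
  -- contradicts the right maximality of `m = fy`.
  have ht : t.length = 0 := by
    by_contra ht
    obtain ⟨d, t, k, rfl, hk⟩ := exists_factorization t (t.length - 1) (by omega)
    have hk1 : k.length = 1 := by
      rw [Quiver.Path.length_comp] at hk ht; omega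
    have hkB := (h.closed _ _ (h.closed _ _ hn.mem).1).2
    cases h.ext_right hkB hf rfl (hk1.trans hf1.symm)
    have h1 := hn.mem
    rw [Quiver.Path.comp_assoc] at h1
    have h2 := (h.closed _ _ h1).2
    rw [← Quiver.Path.comp_assoc] at h2
    have := hm.right _ g h2
    omega
  cases t with
  | cons => simp at ht
  | nil =>
    rw [Quiver.Path.nil_comp] at hn
    have := hn.right _ z hm'.mem
    simp only [Quiver.Path.length_comp]
    omega

/-! ### The successor permutation -/

/-- The vertices of a balanced set of paths. -/
abbrev _root_.pathVertices (B : Set (QuiverPath V)) : Type u :=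
  {a : V // (⟨a, a, .nil⟩ : QuiverPath V) ∈ B}

/-- The length of the longest path starting in `a`. -/
def maxLength (h : IsBalanced B) (a : pathVertices B) : ℕ :=
  (h.exists_bimaximal_from a.2).choose_spec.choose.length

theorem length_eq_maxLength (h : IsBalanced B) (a : pathVertices B) {b : V}
    {m : Quiver.Path a.1 b} (hm : IsBimaximal B m) : m.length = h.maxLength a := by
  have hm' := (h.exists_bimaximal_from a.2).choose_spec.choose_spec
  obtain ⟨y, hy⟩ := h.exists_comp_eq hm hm'.mem
  have := hm'.right _ y (by rw [hy]; exact hm.mem)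
  rw [← hy, Quiver.Path.length_comp, this]
  rfl

theorem length_le_maxLength (h : IsBalanced B) (a : pathVertices B) {p : QuiverPath V}
    (hp : p ∈ B) (hpa : p.1 = a) : p.length ≤ h.maxLength a := by
  obtain ⟨a, ha⟩ := a
  obtain ⟨a', b, p⟩ := p
  obtain rfl : a' = a := hpa
  have hm' := (h.exists_bimaximal_from ha).choose_spec.choose_spec
  obtain ⟨y, hy⟩ := h.exists_comp_eq hm' hp
  have h2 := congrArg Quiver.Path.length hy
  rw [Quiver.Path.length_comp] at h2
  exact Nat.le.intro h2

theorem exists_length_eq (h : IsBalanced B) (a : pathVertices B) {k : ℕ}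
    (hk : k ≤ h.maxLength a) : ∃ p ∈ B, p.1 = a ∧ p.length = k := by
  have hm' := (h.exists_bimaximal_from a.2).choose_spec.choose_spec
  obtain ⟨b, q, r, hqr, hq⟩ := exists_factorization _ k hk
  rw [← hqr] at hm'
  exact ⟨_, (h.closed _ _ hm'.mem).1, rfl, hq⟩

/-- Fixing the vertices without outgoing arrow makes the successor total and bijective. A vertex
with a loop in `B` is fixed too; the maximal length tells the two cases apart. -/
theorem exists_next (h : IsBalanced B) (a : pathVertices B) :
    ∃ b : pathVertices B, (h.maxLength a = 0 → b = a) ∧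
      ∀ p ∈ B, p.1 = a → p.length = 1 → p.2.1 = b := by
  by_cases ha : h.maxLength a = 0
  · exact ⟨a, fun _ => rfl, fun p hp h1 h2 => by
      have := h.length_le_maxLength a hp h1; omega⟩
  · obtain ⟨q, hq, hqa, hq1⟩ := h.exists_length_eq a (k := 1) (by omega)
    refine ⟨⟨_, h.nil_right hq⟩, fun h0 => (ha h0).elim, fun p hp h1 h2 => ?_⟩
    rw [h.ext_left hp hq (h1.trans hqa.symm) (h2.trans hq1.symm)]

/-- The vertex following `a` on the longest path starting in `a`, or `a` if that path is trivial. -/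
def next (h : IsBalanced B) (a : pathVertices B) : pathVertices B := (h.exists_next a).choose

theorem next_of_maxLength_eq_zero (h : IsBalanced B) {a : pathVertices B}
    (ha : h.maxLength a = 0) : h.next a = a :=
  (h.exists_next a).choose_spec.1 ha

theorem end_eq_next (h : IsBalanced B) {a : pathVertices B} {p : QuiverPath V} (hp : p ∈ B)
    (h1 : p.1 = a) (h2 : p.length = 1) : p.2.1 = h.next a :=
  (h.exists_next a).choose_spec.2 p hp h1 h2

theorem maxLength_next (h : IsBalanced B) (a : pathVertices B) :
    h.maxLength (h.next a) = h.maxLength a := by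
  by_cases ha : h.maxLength a = 0
  · rw [h.next_of_maxLength_eq_zero ha]
  · obtain ⟨q, hq, hqa, hq1⟩ := h.exists_length_eq a (k := 1) (by omega)
    have hn := h.end_eq_next hq hqa hq1
    obtain ⟨a, haB⟩ := a
    obtain ⟨a', b, q⟩ := q
    obtain rfl : a' = a := hqa
    obtain ⟨c, m, hm⟩ := h.exists_bimaximal_from haB
    obtain ⟨c', m', hm'⟩ := h.exists_bimaximal_from (h.nil_right hq)
    have h1 := h.length_eq_of_arrow hq hq1 hm hm'
    rw [← h.length_eq_maxLength ⟨a', haB⟩ hm, ← h1, h.length_eq_maxLength ⟨b, h.nil_right hq⟩ hm']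
    congr 1
    exact Subtype.ext hn.symm

/-- Vertices with the same successor have the same maximal length; if it is positive, their arrows
have a common end and coincide by `ext_right`. For surjectivity, a predecessor is the source of the
last arrow of a bimaximal path ending in the vertex. -/
theorem bijective_next (h : IsBalanced B) : Function.Bijective h.next := by
  constructor
  · intro a b hab
    have hl : h.maxLength a = h.maxLength b := by
      rw [← h.maxLength_next a, hab, h.maxLength_next b]
    by_cases ha : h.maxLength a = 0
    · rw [← h.next_of_maxLength_eq_zero ha, hab, h.next_of_maxLength_eq_zero (hl ▸ ha)]
    · obtain ⟨p, hp, hpa, hp1⟩ := h.exists_length_eq a (k := 1) (by omega)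
      obtain ⟨q, hq, hqb, hq1⟩ := h.exists_length_eq b (k := 1) (by omega)
      have := h.ext_right hp hq (by rw [h.end_eq_next hp hpa hp1, h.end_eq_next hq hqb hq1, hab])
        (hp1.trans hq1.symm)
      exact Subtype.ext (by rw [← hpa, ← hqb, this])
  · intro a
    by_cases ha : h.maxLength a = 0
    · exact ⟨a, h.next_of_maxLength_eq_zero ha⟩
    · obtain ⟨b, n, hn⟩ := h.exists_bimaximal_to a.2
      -- A trivial `n` would be extended on the right by the arrow leaving `a`.
      have hn0 : n.length ≠ 0 := by
        intro hn0
        obtain ⟨q, hq, hqa, hq1⟩ := h.exists_length_eq a (k := 1) (by omega)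
        obtain ⟨a, haB⟩ := a
        obtain ⟨a', b', q⟩ := q
        obtain rfl : a' = a := hqa
        cases n with
        | cons => simp at hn0
        | nil =>
          have h1 := hn.right _ q (by rw [Quiver.Path.nil_comp]; exact hq)
          have h2 : q.length = 1 := hq1
          omega
      obtain ⟨c, n, k, rfl, hk⟩ := exists_factorization n (n.length - 1) (by omega)
      have hk1 : k.length = 1 := by
        rw [Quiver.Path.length_comp] at hk hn0; omega
      have hkB := (h.closed _ _ hn.mem).2
      exact ⟨⟨c, h.nil_left hkB⟩, Subtype.ext (h.end_eq_next hkB rfl hk1).symm⟩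

/-- `IsBalanced.next` as a permutation. -/
def shift (h : IsBalanced B) : Equiv.Perm (pathVertices B) := Equiv.ofBijective _ h.bijective_next

theorem end_eq_shift_pow (h : IsBalanced B) {p : QuiverPath V} (hp : p ∈ B) (a : pathVertices B)
    (hpa : p.1 = a) : p.2.1 = (h.shift ^ p.length) a := by
  obtain ⟨a, ha⟩ := a
  obtain ⟨a', b, p⟩ := p
  obtain rfl : a' = a := hpa
  induction p with
  | nil => rfl
  | cons p f ih =>
    obtain ⟨h1, h2⟩ := h.closed p f.toPath hp
    have h3 := ih h1
    change _ = (((h.shift ^ (p.length + 1)) ⟨a', ha⟩ : pathVertices B) : V)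
    rw [pow_succ', Equiv.Perm.mul_apply]
    exact h.end_eq_next (p := ⟨_, _, f.toPath⟩) h2 h3 rfl

theorem maxLength_smul (h : IsBalanced B) {g : Equiv.Perm (pathVertices B)}
    (hg : g ∈ Subgroup.zpowers h.shift) (a : pathVertices B) :
    h.maxLength (g a) = h.maxLength a := by
  obtain ⟨k, rfl⟩ := Subgroup.mem_zpowers_iff.1 hg
  clear hg
  induction k with
  | zero => rfl
  | succ k ih =>
    rw [add_comm, zpow_add, zpow_one, Equiv.Perm.mul_apply, ← ih]
    exact h.maxLength_next _
  | pred k ih =>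
    rw [sub_eq_add_neg, add_comm, zpow_add, zpow_neg_one, Equiv.Perm.mul_apply, ← ih,
      ← h.maxLength_next]
    exact congrArg h.maxLength (h.shift.apply_symm_apply _)

/-! ### Components as orbits of the shift -/

/-- The component of a path: the orbit of its starting vertex. -/
def component (h : IsBalanced B) (p : B) :
    MulAction.orbitRel.Quotient (Subgroup.zpowers h.shift) (pathVertices B) :=
  Quotient.mk'' ⟨p.1.1, h.nil_left p.2⟩

/-- The paths in the given component. -/
def componentPaths (h : IsBalanced B)
    (i : MulAction.orbitRel.Quotient (Subgroup.zpowers h.shift) (pathVertices B)) :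
    Set (QuiverPath V) := {p | ∃ hp : p ∈ B, h.component ⟨p, hp⟩ = i}

theorem componentPaths_subset (h : IsBalanced B)
    (i : MulAction.orbitRel.Quotient (Subgroup.zpowers h.shift) (pathVertices B)) :
    h.componentPaths i ⊆ B := fun _ hp => hp.1

/-- The second factor starts where the first one ends, which is a power of the shift applied to the
common start. -/
theorem factorClosed_componentPaths (h : IsBalanced B)
    (i : MulAction.orbitRel.Quotient (Subgroup.zpowers h.shift) (pathVertices B)) :
    FactorClosed (h.componentPaths i) := by
  rintro a b c q r ⟨hp, rfl⟩
  obtain ⟨hq, hr⟩ := h.closed q r hp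
  refine ⟨⟨hq, rfl⟩, hr, ?_⟩
  refine Quotient.sound ?_
  refine ⟨⟨h.shift ^ q.length, Subgroup.npow_mem_zpowers _ _⟩, ?_⟩
  exact Subtype.ext (h.end_eq_shift_pow hq ⟨a, h.nil_left hp⟩ rfl).symm

/-- The orbit of `x` under the cyclic group generated by the shift is a copy of `ZMod n`, adding `1`
corresponding to one shift; this covers finite and infinite orbits together. -/
theorem hasShiftBasis_component {K D : Type*} [Field K] [AddCommGroup D] [Module K D]
    [Coalgebra K D] {e : QuiverPath V → D} (h : IsBalanced B)
    (x : pathVertices B) (he : IsPathFamily K (h.componentPaths (Quotient.mk'' x)) e) :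
    HasShiftBasis K D (Function.minimalPeriod (h.shift • ·) x) (h.maxLength x) := by
  set n := Function.minimalPeriod (h.shift • ·) x
  let E := (MulAction.orbitZPowersEquiv h.shift x).symm
  have hE : ∀ k : ℤ, (E (k : ZMod n) : pathVertices B) = (h.shift ^ k) x := fun k => by
    rw [MulAction.orbitZPowersEquiv_symm_apply']; rfl
  have hadd : ∀ (y : ZMod n) (k : ℕ),
      (E (y + k) : pathVertices B) = (h.shift ^ k) (E y : pathVertices B) := by
    intro y k
    obtain ⟨z, rfl⟩ := ZMod.intCast_surjective y
    have : ((z : ZMod n) + k) = ((k + z : ℤ) : ZMod n) := by push_cast; ring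
    rw [this, hE, hE, zpow_add, zpow_natCast]; rfl
  have hlen : ∀ y : ZMod n, h.maxLength (E y) = h.maxLength x := by
    intro y
    obtain ⟨z, rfl⟩ := ZMod.intCast_surjective y
    rw [hE]
    exact h.maxLength_smul (Subgroup.zpow_mem_zpowers _ _) _
  have hstart : ∀ p ∈ h.componentPaths (Quotient.mk'' x),
      ∃ y : ZMod n, p.1 = ((E y : pathVertices B) : V) := by
    rintro p ⟨hp, hpx⟩
    have : (⟨p.1, h.nil_left hp⟩ : pathVertices B) ∈
        MulAction.orbit (Subgroup.zpowers h.shift) x := Quotient.exact hpx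
    exact ⟨E.symm ⟨_, this⟩, by rw [E.apply_symm_apply]⟩
  refine he.hasShiftBasis (fun y => ((E y : pathVertices B) : V)) ?_ ?_ ?_ ?_
  · exact fun y z hyz => E.injective (Subtype.ext (Subtype.ext hyz))
  · intro y k hk
    obtain ⟨p, hp, h1, h2⟩ := h.exists_length_eq (E y) (k := k) (by rw [hlen]; exact hk)
    refine ⟨p, ⟨hp, ?_⟩, h1, h2⟩
    refine Quotient.sound ?_
    have h3 : (⟨p.1, h.nil_left hp⟩ : pathVertices B) = E y := Subtype.ext h1
    change _ ∈ MulAction.orbit (Subgroup.zpowers h.shift) x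
    rw [h3]
    exact (E y).2
  · exact fun p hp q hq => h.ext_left hp.1 hq.1
  · intro p hp
    obtain ⟨y, hy⟩ := hstart p hp
    refine ⟨?_, y, hy, ?_⟩
    · rw [← hlen y]; exact h.length_le_maxLength _ hp.1 hy
    · rw [hadd]; exact h.end_eq_shift_pow hp.1 _ hy

theorem isStandard_component {K : Type w} {D : Type*} [Field K] [AddCommGroup D] [Module K D]
    [Coalgebra K D] {e : QuiverPath V → D} (h : IsBalanced B)
    (i : MulAction.orbitRel.Quotient (Subgroup.zpowers h.shift) (pathVertices B))
    (he : IsPathFamily K (h.componentPaths i) e) : IsStandardCoFrobenius K D := by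
  induction i using Quotient.inductionOn' with
  | h x =>
  have hb := h.hasShiftBasis_component x he
  rcases Nat.eq_zero_or_pos (h.maxLength x) with hs | hs
  · have hn : Function.minimalPeriod (h.shift • ·) x = 1 :=
      -- For `s = 0` the convention on `next` makes `x` a fixed point, so the orbit is a single
      -- vertex.
      Function.minimalPeriod_eq_one_iff_isFixedPt.2 (h.next_of_maxLength_eq_zero hs)
    rw [hs, hn] at hb
    exact Or.inr (Or.inr (hb.nonempty_coalgEquiv (hasShiftBasis_trivial K)))
  · rcases Nat.eq_zero_or_pos (Function.minimalPeriod (h.shift • ·) x) with hn | hn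
    · rw [hn] at hb
      exact Or.inl ⟨_, hs, hb.nonempty_coalgEquiv (hasShiftBasis_line K _)⟩
    · exact Or.inr (Or.inl ⟨_, _, hn, hs, hb.nonempty_coalgEquiv (hasShiftBasis_cycle K _ _)⟩)

end IsBalanced

/-! ### The direct sum decomposition -/

theorem IsPathFamily.isInternal_of_partition {K D ι : Type*} [Field K] [AddCommGroup D]
    [Module K D] [Coalgebra K D] {V : Type*} [Quiver V] {B : Set (QuiverPath V)}
    {e : QuiverPath V → D} [DecidableEq ι] (h : IsPathFamily K B e) (P : ι → Set (QuiverPath V))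
    (hP : ⋃ i, P i = B) (hdisj : ∀ i j, i ≠ j → Disjoint (P i) (P j)) :
    DirectSum.IsInternal fun i => Submodule.span K (e '' P i) := by
  have hsub : ∀ i, P i ⊆ B := fun i => hP ▸ Set.subset_iUnion P i
  refine DirectSum.isInternal_submodule_of_iSupIndep_of_iSup_eq_top ?_ ?_
  · intro i
    have h1 : ⨆ j, ⨆ _ : j ≠ i, Submodule.span K (e '' P j) ≤
        Submodule.span K (e '' (B \ P i)) := by
      refine iSup₂_le fun j hj => Submodule.span_mono (Set.image_mono ?_)
      exact Set.subset_sdiff.2 ⟨hsub j, hdisj j i hj⟩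
    refine Disjoint.mono_right h1 ?_
    have h2 := LinearIndependent.disjoint_span_image h.linInd
      (s := {p : B | p.1 ∈ P i}) (t := {p : B | p.1 ∈ B \ P i})
      (Set.disjoint_left.2 fun p hp hp' => hp'.2 hp)
    have himage : ∀ Q ⊆ B, (fun p : B => e p) '' {p : B | p.1 ∈ Q} = e '' Q := by
      intro Q hQ
      ext y
      constructor
      · rintro ⟨p, hp, rfl⟩; exact ⟨p, hp, rfl⟩
      · rintro ⟨p, hp, rfl⟩; exact ⟨⟨p, hQ hp⟩, hp, rfl⟩
    rwa [himage _ (hsub i), himage _ Set.sdiff_subset] at h2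
  · rw [← Submodule.span_iUnion, ← Set.image_iUnion, hP, h.span_eq]

end

theorem mainTheorem6 {K : Type w} [Field K] {V : Type u} [Quiver.{v} V]
    (C : Subcoalgebra K (PathCoalgebra K V)) (hC : PathCoalgebra.IsPathSubcoalgebra C)
    (hleft : IsLeftCoFrobenius K C) (hright : IsRightCoFrobenius K C) :
    ∃ (ι : Type u) (_ : DecidableEq ι) (D : ι → Subcoalgebra K C),
      DirectSum.IsInternal D ∧ ∀ i, IsStandardCoFrobenius K (D i) := by
  classical
  obtain ⟨B, b, hb⟩ := hC
  have hspan : C.toSubmodule = Submodule.span K (PathCoalgebra.basis K V '' B) := by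
    have h1 : LinearMap.range C.subtype = C.toSubmodule := Submodule.range_subtype _
    rw [← h1, LinearMap.range_eq_map, ← b.span_eq, Submodule.map_span, ← Set.range_comp,
      Set.image_eq_range]
    exact congrArg _ (congrArg Set.range (funext hb))
  obtain ⟨e, he⟩ := (isPathFamily_univ (V := V) K).exists_subcoalgebra C (Set.subset_univ B)
    (factorClosed_of_subcoalgebra C B hspan) hspan
  have h := he.isBalanced hleft hright
  -- The summands are indexed by the orbits of the shift, each spanned by the paths of `B` that
  -- start in the orbit; these sets of paths partition `B`.
  refine ⟨MulAction.orbitRel.Quotient (Subgroup.zpowers h.shift) (pathVertices B),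
    inferInstance, fun i => he.subcoalgebra _ (h.componentPaths_subset i)
      (h.factorClosed_componentPaths i), ?_, fun i => ?_⟩
  · refine he.isInternal_of_partition h.componentPaths ?_ ?_
    · ext p
      simp [IsBalanced.componentPaths]
    · intro i j hij
      refine Set.disjoint_left.2 ?_
      rintro p ⟨hp, rfl⟩ ⟨_, rfl⟩
      exact hij rfl
  · obtain ⟨e', he'⟩ := he.exists_subcoalgebra
      (he.subcoalgebra _ (h.componentPaths_subset i) (h.factorClosed_componentPaths i))
      (h.componentPaths_subset i) (h.factorClosed_componentPaths i) rfl
    exact h.isStandard_component i he'
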